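/- Let $t \geq 128$ be a rational integer and put $$\epsilon = \frac{t+\sqrt{t^2+16}}{4}, \qquad \rho = \sqrt{1+\epsilon^2}, \qquad \kappa = \frac{\log(8\epsilon)}{\log(\epsilon/8)}.$$ Let $$\beta^{(0)} = \epsilon-\rho, \qquad \beta^{(1)} = \frac{\rho-1}{\epsilon}, \qquad \beta^{(2)} = \rho+\epsilon, \qquad \beta^{(3)} = -\frac{\rho+1}{\epsilon},$$ which are the four roots of $X^4-tX^3-6X^2+tX+1$. Then for $j = 0,1,2,3$ and all rational integers $p$ and $q$ with $|q| > 0.16\,t$, one has $$\left| p - \beta^{(j)} q \right| > \frac{1}{c_j |q|^{\kappa}},$$ where $$c_0 = c_1 = c_3 = 11.33\, t \cdot 0.4^{\kappa} \qquad \text{and} \qquad c_2 = 8.01\, t\, (0.4\, t)^{\kappa}.$$ -/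

import Mathlib

namespace SimplestQuartic

/-- `ε = (t + √(t² + 16)) / 4`. -/
noncomputable def eps (t : ℤ) : ℝ := ((t : ℝ) + √((t : ℝ) ^ 2 + 16)) / 4

/-- `ρ = √(1 + ε²)`. -/
noncomputable def rho (t : ℤ) : ℝ := √(1 + eps t ^ 2)

/-- The numbers `β⁽⁰⁾ = ε - ρ`, `β⁽¹⁾ = (ρ - 1) / ε`, `β⁽²⁾ = ρ + ε`, `β⁽³⁾ = -(ρ + 1) / ε`. -/
noncomputable def beta (t : ℤ) : Fin 4 → ℝ :=
  ![eps t - rho t, (rho t - 1) / eps t, rho t + eps t, -((rho t + 1) / eps t)]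

/-- `κ = log (8 ε) / log (ε / 8)`. -/
noncomputable def kappa (t : ℤ) : ℝ := Real.log (8 * eps t) / Real.log (eps t / 8)

/-- The constants `c₀ = c₁ = c₃ = 11.33 t · 0.4 ^ κ` and `c₂ = 8.01 t (0.4 t) ^ κ`. -/
noncomputable def c (t : ℤ) : Fin 4 → ℝ :=
  ![11.33 * (t : ℝ) * (0.4 : ℝ) ^ kappa t,
    11.33 * (t : ℝ) * (0.4 : ℝ) ^ kappa t,
    8.01 * (t : ℝ) * (0.4 * (t : ℝ)) ^ kappa t,
    11.33 * (t : ℝ) * (0.4 : ℝ) ^ kappa t]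

theorem eps_pos (t : ℤ) : 0 < eps t := by
  have h : |(t : ℝ)| < √((t : ℝ) ^ 2 + 16) := by
    rw [← Real.sqrt_sq_eq_abs]
    exact Real.sqrt_lt_sqrt (sq_nonneg _) (by linarith)
  have h2 := neg_abs_le (t : ℝ)
  unfold eps
  linarith

/-- The `β⁽ʲ⁾` are the four roots of `X⁴ - t X³ - 6 X² + t X + 1`. -/
theorem quartic_eq_prod (t : ℤ) (x : ℝ) :
    x ^ 4 - t * x ^ 3 - 6 * x ^ 2 + t * x + 1 = ∏ j : Fin 4, (x - beta t j) := by
  have he := (eps_pos t).ne'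
  have hq : 2 * eps t ^ 2 = t * eps t + 2 := by
    have hs : √((t : ℝ) ^ 2 + 16) ^ 2 = (t : ℝ) ^ 2 + 16 := Real.sq_sqrt (by positivity)
    unfold eps
    linear_combination (1 / 8 : ℝ) * hs
  have hr : rho t ^ 2 = 1 + eps t ^ 2 := Real.sq_sqrt (by positivity)
  have ht : (t : ℝ) = (2 * eps t ^ 2 - 2) / eps t := by
    field_simp
    linarith
  have h02 : (x - (eps t - rho t)) * (x - (rho t + eps t)) = x ^ 2 - 2 * eps t * x - 1 := by
    linear_combination -hr
  have h13 : (x - (rho t - 1) / eps t) * (x - -((rho t + 1) / eps t)) =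
      x ^ 2 + 2 / eps t * x - 1 := by
    field_simp
    linear_combination -hr
  have hp : ∏ j : Fin 4, (x - beta t j) =
      ((x - (eps t - rho t)) * (x - (rho t + eps t))) *
        ((x - (rho t - 1) / eps t) * (x - -((rho t + 1) / eps t))) := by
    simp [Fin.prod_univ_four, beta]
    ring
  rw [hp, h02, h13, ht]
  field_simp
  ring

end SimplestQuartic

/-! Let g be the principal fourth root of t + 4i and T = Im g / Re g. Comparing real and imaginary
parts in g⁴ = t + 4i shows that -T is a root of the quartic; it lies in [-1, 0], hence T = ρ - ε.
The other roots are (1 - T)/(1 + T), 1/T and -(1 + T)/(1 - T), so good approximations to T give good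
approximations to all four.

The approximations come from diagonal Padé approximants to the fourth root, taken at (t + 4i)/(t -
4i). After scaling, the numerators are Gaussian integers M_n + N_n i, because the powers of 8 clear
the denominators of binom(n + 1/4, k) (`factorial_dvd_two_pow_mul_prod`). They satisfy a three-term
recurrence whose coefficients at this point are rational integers, so M_n and N_n satisfy it
separately (`padeRec_re_im`).

The sharp estimates come from the recurrence. Its limiting characteristic equation X² = 4tX + 64 has
the root 8ε, whence M_n ≤ (8ε)^n. The Casoratian of M and N is nonzero and at most 2·64^n/(n + 1),
which makes |M_n T - N_n| of order (8/ε)^n (`abs_padeRe_mul_sub_padeIm_le`). Hermite's integrals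
enter only through a crude bound 16^n on the remainders, enough to show N_n/M_n → T
(`tendsto_padeIm_div_padeRe`).

Finally, given q, choose n with (ε/8)^n comparable to |q|. One of two consecutive approximations U/V
differs from p/q, so |Vp - Uq| ≥ 1, the approximation error uses up less than 1/2, and |p - βq| >
1/(2|V|). The exponent κ is the one with (ε/8)^κ = 8ε. -/

namespace SimplestQuartic

open Filter Topology

/-! ### Integrality of the scaled binomial coefficients -/

/-- `k!` divides `2 ^ k` times any product of `k` terms of an arithmetic progression of
difference `4`. -/
theorem factorial_dvd_two_pow_mul_prod (a : ℤ) (k : ℕ) :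
    (k.factorial : ℤ) ∣ 2 ^ k * ∏ j ∈ Finset.range k, (a - 4 * (j : ℤ)) := by
  obtain ⟨e, m, hm, hk⟩ := Nat.exists_eq_two_pow_mul_odd (Nat.factorial_ne_zero k)
  -- Legendre's formula: the 2-adic valuation of k! is k minus its binary digit sum.
  have hek : e ≤ k := by
    have h1 : (2 : ℕ) ^ e ∣ k.factorial := Dvd.intro _ hk.symm
    have h2 := (padicValNat_dvd_iff_le (p := 2) (Nat.factorial_ne_zero k)).1 h1
    have h3 := sub_one_mul_padicValNat_factorial (p := 2) k
    omega
  have hmk : (m : ℤ) ∣ (k.factorial : ℤ) := Int.natCast_dvd_natCast.2 (Dvd.intro_left _ hk.symm)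
  rw [hk]
  push_cast
  refine mul_dvd_mul (pow_dvd_pow _ hek) ?_
  have hcop : IsCoprime (m : ℤ) 4 := by
    have h : Nat.Coprime m 4 := by
      have := (Nat.coprime_two_right.2 hm).pow_right 2
      simpa using this
    exact_mod_cast Nat.isCoprime_iff_coprime.2 h
  obtain ⟨u, v, huv⟩ := hcop
  -- Modulo the odd part m, v inverts 4, which turns the progression into -4 times consecutive
  -- integers.
  have hmod : ∏ j ∈ Finset.range k, (a - 4 * (j : ℤ)) ≡
      ∏ j ∈ Finset.range k, (-4 * (-(a * v) + (j : ℤ))) [ZMOD m] := by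
    refine Int.ModEq.prod fun j _ => ?_
    refine Int.ModEq.symm (Int.modEq_iff_dvd.2 ⟨a * u, ?_⟩)
    linear_combination -a * huv
  rw [hmod.dvd_iff, Finset.prod_mul_distrib]
  exact (hmk.trans (Nat.factorial_coe_dvd_prod k _)).mul_left _

/-- The integer `8 ^ k * binom (n + 1/4, k)`. -/
def scaledChoose (n k : ℕ) : ℤ :=
  (2 ^ k * ∏ j ∈ Finset.range k, ((4 * n + 1 : ℤ) - 4 * (j : ℤ))) / (k.factorial : ℤ)

theorem scaledChoose_mul_factorial (n k : ℕ) :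
    scaledChoose n k * (k.factorial : ℤ) =
      2 ^ k * ∏ j ∈ Finset.range k, ((4 * n + 1 : ℤ) - 4 * (j : ℤ)) :=
  Int.ediv_mul_cancel (factorial_dvd_two_pow_mul_prod _ _)

@[simp] theorem scaledChoose_zero (n : ℕ) : scaledChoose n 0 = 1 := by simp [scaledChoose]

theorem scaledChoose_succ (n k : ℕ) :
    scaledChoose n (k + 1) * (k + 1) = 2 * (4 * (n : ℤ) + 1 - 4 * k) * scaledChoose n k := by
  have h0 : (k.factorial : ℤ) ≠ 0 := by exact_mod_cast k.factorial_ne_zero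
  have h1 := scaledChoose_mul_factorial n k
  have h2 := scaledChoose_mul_factorial n (k + 1)
  rw [Finset.prod_range_succ, Nat.factorial_succ] at h2
  push_cast at h2
  apply mul_right_cancel₀ h0
  linear_combination h2 - 2 * (4 * (n : ℤ) + 1 - 4 * k) * h1

theorem scaledChoose_succ_succ (n k : ℕ) :
    scaledChoose (n + 1) (k + 1) * (k + 1) = 2 * (4 * (n : ℤ) + 5) * scaledChoose n k := by
  have h0 : (k.factorial : ℤ) ≠ 0 := by exact_mod_cast k.factorial_ne_zero
  have h1 := scaledChoose_mul_factorial n k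
  have h2 := scaledChoose_mul_factorial (n + 1) (k + 1)
  rw [Finset.prod_range_succ', Nat.factorial_succ] at h2
  have h3 : ∏ j ∈ Finset.range k, ((4 * (n + 1 : ℕ) + 1 : ℤ) - 4 * ((j + 1 : ℕ) : ℤ)) =
      ∏ j ∈ Finset.range k, ((4 * n + 1 : ℤ) - 4 * (j : ℤ)) :=
    Finset.prod_congr rfl fun j _ => by push_cast; ring
  rw [h3] at h2
  push_cast at h2
  apply mul_right_cancel₀ h0
  linear_combination h2 - 2 * (4 * (n : ℤ) + 5) * h1

/-! ### Recurrence for the Padé numerators -/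

/-- The coefficients `binom (2n - k, n) * 8 ^ k * binom (n + 1/4, k)` of the Padé numerators. -/
def padeCoeff (n k : ℕ) : ℤ := ((2 * n - k).choose n : ℤ) * scaledChoose n k

/-- Positivity of n matters: for n = 0 truncated subtraction makes the binomial factor 1 for every
k. -/
theorem padeCoeff_eq_zero {n k : ℕ} (h : n < k) (hn : 0 < n) : padeCoeff n k = 0 := by
  rw [padeCoeff, Nat.choose_eq_zero_of_lt (by omega)]
  simp

theorem padeCoeff_zero_rec (m : ℕ) :
    ((m : ℤ) + 2) * padeCoeff (m + 2) 0 = (2 * m + 3) * 2 * padeCoeff (m + 1) 0 := by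
  have h := Nat.succ_mul_centralBinom_succ (m + 1)
  simp only [Nat.centralBinom] at h
  simp only [padeCoeff, scaledChoose_zero, Nat.sub_zero, mul_one]
  have h' : (((m + 1 + 1 : ℕ) * (2 * (m + 1 + 1)).choose (m + 1 + 1) : ℕ) : ℤ) =
    ((2 * (2 * (m + 1) + 1) * (2 * (m + 1)).choose (m + 1) : ℕ) : ℤ) := by exact_mod_cast h
  push_cast at h'
  linear_combination h'

/-- Every term is a rational multiple of `(m + s).choose m * scaledChoose m l`, with s = m - l, so
the claim reduces to an identity of rational functions. The cases k = 0 and k = 1 are separate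
because the y² term of the recurrence does not reach them. -/
theorem padeCoeff_rec (m s l : ℕ) (hm : m = s + l) :
    ((m : ℤ) + 1) * (m + 2) * padeCoeff (m + 2) (l + 2) =
      (2 * m + 3) * (m + 1) * (2 * padeCoeff (m + 1) (l + 2) + 8 * padeCoeff (m + 1) (l + 1)) -
        (64 * (m + 1) ^ 2 - 4) * padeCoeff m l := by
  have e1 : 2 * (m + 2) - (l + 2) = m + s + 2 := by omega
  have e2 : 2 * (m + 1) - (l + 2) = m + s := by omega
  have e3 : 2 * (m + 1) - (l + 1) = m + s + 1 := by omega
  have e4 : 2 * m - l = m + s := by omega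
  simp only [padeCoeff, e1, e2, e3, e4]
  have b1 : ((m + s).choose (m + 1) : ℤ) * (m + 1) = (m + s).choose m * s := by
    have := Nat.choose_succ_right_eq (m + s) m
    rw [Nat.add_sub_cancel_left] at this
    exact_mod_cast this
  have b2 : ((m + s + 1).choose (m + 1) : ℤ) * (m + 1) = (m + s + 1) * (m + s).choose m := by
    exact_mod_cast (Nat.add_one_mul_choose_eq (m + s) m).symm
  have b3 : ((m + s + 2).choose (m + 2) : ℤ) * (m + 2) =
      (m + s + 2) * (m + s + 1).choose (m + 1) := by
    exact_mod_cast (Nat.add_one_mul_choose_eq (m + s + 1) (m + 1)).symm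
  have g1 := scaledChoose_succ_succ m l
  have g2 := scaledChoose_succ_succ (m + 1) (l + 1)
  have g3 := scaledChoose_succ (m + 1) (l + 1)
  push_cast at g2 g3
  have hm' : (m : ℤ) = s + l := by exact_mod_cast hm
  generalize ((m + s).choose (m + 1) : ℤ) = X1 at *
  generalize ((m + s + 1).choose (m + 1) : ℤ) = X2 at *
  generalize ((m + s + 2).choose (m + 2) : ℤ) = X3 at *
  generalize ((m + s).choose m : ℤ) = X at *
  generalize scaledChoose (m + 1) (l + 1) = Y1 at *
  generalize scaledChoose (m + 1) (l + 2) = Y3 at *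
  generalize scaledChoose (m + 2) (l + 2) = Y2 at *
  generalize scaledChoose m l = Y at *
  have key : ∀ x x1 x2 x3 y y1 y2 y3 m s l : ℚ, 0 ≤ m → 0 ≤ l → m = s + l →
      x1 * (m + 1) = x * s → x2 * (m + 1) = (m + s + 1) * x → x3 * (m + 2) = (m + s + 2) * x2 →
      y1 * (l + 1) = 2 * (4 * m + 5) * y → y2 * (l + 1 + 1) = 2 * (4 * (m + 1) + 5) * y1 →
      y3 * (l + 1 + 1) = 2 * (4 * (m + 1) + 1 - 4 * (l + 1)) * y1 →
      (m + 1) * (m + 2) * (x3 * y2) =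
        (2 * m + 3) * (m + 1) * (2 * (x1 * y3) + 8 * (x2 * y1)) -
          (64 * (m + 1) ^ 2 - 4) * (x * y) := by
    intro x x1 x2 x3 y y1 y2 y3 m s l hm0 hl0 hm h1 h2 h3 h4 h5 h6
    have p1 : m + 1 ≠ 0 := by positivity
    have p2 : m + 2 ≠ 0 := by positivity
    have p3 : l + 1 ≠ 0 := by positivity
    have p4 : l + 1 + 1 ≠ 0 := by positivity
    rw [← eq_div_iff p1] at h1 h2
    rw [← eq_div_iff p2] at h3
    rw [← eq_div_iff p3] at h4
    rw [← eq_div_iff p4] at h5 h6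
    rw [h5, h6, h3, h4, h1, h2]
    obtain rfl : s = m - l := by linarith
    field_simp
    ring
  have := key X X1 X2 X3 Y Y1 Y2 Y3 m s l (by positivity) (by positivity) (by exact_mod_cast hm')
    (by exact_mod_cast b1) (by exact_mod_cast b2) (by exact_mod_cast b3) (by exact_mod_cast g1)
    (by exact_mod_cast g2) (by exact_mod_cast g3)
  exact_mod_cast this

theorem padeCoeff_one_rec (m : ℕ) :
    ((m : ℤ) + 2) * padeCoeff (m + 2) 1 =
      (2 * m + 3) * (2 * padeCoeff (m + 1) 1 + 8 * padeCoeff (m + 1) 0) := by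
  have e1 : 2 * (m + 2) - 1 = m + (m + 1) + 2 := by omega
  have e2 : 2 * (m + 1) - 1 = m + (m + 1) := by omega
  have e3 : 2 * (m + 1) = m + (m + 1) + 1 := by omega
  have b2 : ((m + (m + 1) + 1).choose (m + 1) : ℤ) * (m + 1) =
      (m + (m + 1) + 1) * (m + (m + 1)).choose m := by
    exact_mod_cast (Nat.add_one_mul_choose_eq (m + (m + 1)) m).symm
  have b3 : ((m + (m + 1) + 2).choose (m + 2) : ℤ) * (m + 2) =
      (m + (m + 1) + 2) * (m + (m + 1) + 1).choose (m + 1) := by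
    exact_mod_cast (Nat.add_one_mul_choose_eq (m + (m + 1) + 1) (m + 1)).symm
  have b1 : ((m + (m + 1)).choose (m + 1) : ℤ) = (m + (m + 1)).choose m := by
    have := Nat.choose_symm_add (a := m) (b := m + 1)
    exact_mod_cast this.symm
  have g1 := scaledChoose_succ (m + 1) 0
  have g2 := scaledChoose_succ (m + 2) 0
  simp only [scaledChoose_zero, zero_add] at g1 g2
  push_cast at g1 g2
  simp only [padeCoeff, scaledChoose_zero, Nat.sub_zero, e1, e2]
  rw [e3, b1]
  have p : (m : ℤ) + 1 ≠ 0 := by positivity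
  apply mul_left_cancel₀ p
  generalize ((m + (m + 1) + 1).choose (m + 1) : ℤ) = X2 at *
  generalize ((m + (m + 1) + 2).choose (m + 2) : ℤ) = X3 at *
  generalize ((m + (m + 1)).choose m : ℤ) = X at *
  have h2 : X2 = 2 * X := by
    apply mul_left_cancel₀ p
    linear_combination b2
  subst h2
  generalize scaledChoose (m + 1) 1 = Y1 at *
  generalize scaledChoose (m + 2) 1 = Y2 at *
  obtain rfl : Y1 = 2 * (4 * (m + 1) + 1) := by linarith
  obtain rfl : Y2 = 2 * (4 * (m + 2) + 1) := by linarith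
  linear_combination (m + 1) * (2 * (4 * ((m : ℤ) + 2) + 1)) * b3

/-- The homogeneous Padé numerator for the fourth root. -/
def padeNum {R : Type*} [CommRing R] (x y : R) (n : ℕ) : R :=
  ∑ k ∈ Finset.range (n + 1), (padeCoeff n k : R) * y ^ k * x ^ (n - k)

theorem padeNum_zero {R : Type*} [CommRing R] (x y : R) : padeNum x y 0 = 1 := by
  simp [padeNum, padeCoeff]

theorem padeNum_one {R : Type*} [CommRing R] (x y : R) : padeNum x y 1 = 2 * x + 10 * y := by
  have : scaledChoose 1 1 = 10 := by simp [scaledChoose]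
  simp [padeNum, padeCoeff, Finset.sum_range_succ, this]

theorem padeNum_rec {R : Type*} [CommRing R] (x y : R) (m : ℕ) :
    ((m : R) + 1) * (m + 2) * padeNum x y (m + 2) =
      (2 * m + 3) * (m + 1) * (2 * x + 8 * y) * padeNum x y (m + 1) -
        (64 * (m + 1) ^ 2 - 4) * y ^ 2 * padeNum x y m := by
  have h2 : padeNum x y (m + 2) = (padeCoeff (m + 2) 0 : R) * x ^ (m + 2) +
      padeCoeff (m + 2) 1 * y * x ^ (m + 1) +
      ∑ l ∈ Finset.range (m + 1), (padeCoeff (m + 2) (l + 2) : R) * (y ^ (l + 2) * x ^ (m - l)) := by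
    rw [padeNum, Finset.sum_range_succ', Finset.sum_range_succ']
    simp only [Nat.add_sub_add_right, mul_assoc]
    simp
    ring
  have h1 : x * padeNum x y (m + 1) = (padeCoeff (m + 1) 0 : R) * x ^ (m + 2) +
      padeCoeff (m + 1) 1 * y * x ^ (m + 1) +
      ∑ l ∈ Finset.range (m + 1), (padeCoeff (m + 1) (l + 2) : R) * (y ^ (l + 2) * x ^ (m - l)) := by
    rw [Finset.sum_range_succ, padeCoeff_eq_zero (n := m + 1) (k := m + 2) (by omega) (by omega)]
    rw [padeNum, Finset.sum_range_succ', Finset.sum_range_succ', mul_add, mul_add, Finset.mul_sum]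
    have : ∀ l ∈ Finset.range m, x * ((padeCoeff (m + 1) (l + 1 + 1) : R) * y ^ (l + 1 + 1) *
        x ^ (m + 1 - (l + 1 + 1))) =
        (padeCoeff (m + 1) (l + 2) : R) * (y ^ (l + 2) * x ^ (m - l)) := by
      intro l hl
      rw [Finset.mem_range] at hl
      have : m - l = (m + 1 - (l + 1 + 1)) + 1 := by omega
      rw [this, pow_succ]
      ring
    rw [Finset.sum_congr rfl this]
    simp
    ring
  have h1' : y * padeNum x y (m + 1) = padeCoeff (m + 1) 0 * y * x ^ (m + 1) +
      ∑ l ∈ Finset.range (m + 1), (padeCoeff (m + 1) (l + 1) : R) * (y ^ (l + 2) * x ^ (m - l)) := by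
    rw [padeNum, Finset.sum_range_succ', mul_add, Finset.mul_sum, add_comm]
    congr 1
    · simp; ring
    · refine Finset.sum_congr rfl fun l _ => ?_
      rw [Nat.add_sub_add_right]
      ring
  have h0 : y ^ 2 * padeNum x y m =
      ∑ l ∈ Finset.range (m + 1), (padeCoeff m l : R) * (y ^ (l + 2) * x ^ (m - l)) := by
    rw [padeNum, Finset.mul_sum]
    exact Finset.sum_congr rfl fun l _ => by ring
  have hs : ((m : R) + 1) * (m + 2) *
      ∑ l ∈ Finset.range (m + 1), (padeCoeff (m + 2) (l + 2) : R) * (y ^ (l + 2) * x ^ (m - l)) =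
      (2 * m + 3) * (m + 1) * (2 *
        ∑ l ∈ Finset.range (m + 1), (padeCoeff (m + 1) (l + 2) : R) * (y ^ (l + 2) * x ^ (m - l)) +
        8 *
        ∑ l ∈ Finset.range (m + 1), (padeCoeff (m + 1) (l + 1) : R) * (y ^ (l + 2) * x ^ (m - l))) -
      (64 * (m + 1) ^ 2 - 4) *
        ∑ l ∈ Finset.range (m + 1), (padeCoeff m l : R) * (y ^ (l + 2) * x ^ (m - l)) := by
    simp only [Finset.mul_sum, ← Finset.sum_add_distrib, ← Finset.sum_sub_distrib]
    refine Finset.sum_congr rfl fun l hl => ?_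
    rw [Finset.mem_range] at hl
    have h := congrArg (Int.cast : ℤ → R) (padeCoeff_rec m (m - l) l (by omega))
    push_cast at h
    linear_combination (y ^ (l + 2) * x ^ (m - l)) * h
  have c0 := congrArg (Int.cast : ℤ → R) (padeCoeff_zero_rec m)
  have c1 := congrArg (Int.cast : ℤ → R) (padeCoeff_one_rec m)
  push_cast at c0 c1
  linear_combination ((m : R) + 1) * (m + 2) * h2 - 2 * ((2 * m + 3) * (m + 1)) * h1 -
    8 * ((2 * m + 3) * (m + 1)) * h1' + (64 * ((m : R) + 1) ^ 2 - 4) * h0 + hs +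
    (m + 1) * x ^ (m + 2) * c0 + (m + 1) * y * x ^ (m + 1) * c1

/-! ### The recurrence over the Gaussian integers -/

/-- The three-term recurrence satisfied by the Padé numerators. -/
def PadeRec {R : Type*} [CommRing R] (t : R) (u : ℕ → R) : Prop :=
  ∀ m : ℕ, ((m : R) + 1) * (m + 2) * u (m + 2) =
    (2 * m + 3) * (m + 1) * (2 * t) * u (m + 1) + (64 * (m + 1) ^ 2 - 4) * u m

/-- The Padé numerator at the point attached to `t`. -/
def padeGauss (t : ℤ) (n : ℕ) : GaussianInt := padeNum (⟨t, -4⟩ : GaussianInt) ⟨0, 1⟩ n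

theorem padeGauss_zero (t : ℤ) : padeGauss t 0 = 1 := padeNum_zero _ _

theorem padeGauss_one (t : ℤ) : padeGauss t 1 = ⟨2 * t, 2⟩ := by
  rw [padeGauss, padeNum_one, Zsqrtd.ext_iff]
  constructor <;> simp

theorem padeRec_padeGauss (t : ℤ) : PadeRec (t : GaussianInt) (padeGauss t) := by
  intro m
  have h := padeNum_rec (⟨t, -4⟩ : GaussianInt) ⟨0, 1⟩ m
  -- At x = t - 4i, y = i both 2x + 8y = 2t and y² = -1 are rational integers; this lets real and
  -- imaginary parts separate.
  have h1 : (2 * ⟨t, -4⟩ + 8 * ⟨0, 1⟩ : GaussianInt) = 2 * (t : GaussianInt) := by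
    rw [Zsqrtd.ext_iff]; constructor <;> simp
  have h2 : (⟨0, 1⟩ : GaussianInt) ^ 2 = -1 := by
    rw [Zsqrtd.ext_iff, sq]; constructor <;> simp
  rw [h1, h2] at h
  simp only [padeGauss]
  linear_combination h

/-- The real part of `padeGauss`, as a real number. -/
def padeRe (t : ℤ) (n : ℕ) : ℝ := ((padeGauss t n).re : ℝ)

/-- The imaginary part of `padeGauss`, as a real number. -/
def padeIm (t : ℤ) (n : ℕ) : ℝ := ((padeGauss t n).im : ℝ)

theorem padeRec_re_im (t : ℤ) :
    PadeRec (t : ℝ) (padeRe t) ∧ PadeRec (t : ℝ) (padeIm t) := by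
  have key : ∀ m : ℕ, ((((m + 1) * (m + 2) : ℤ) : GaussianInt)) * padeGauss t (m + 2) =
      (((2 * m + 3) * (m + 1) * (2 * t) : ℤ) : GaussianInt) * padeGauss t (m + 1) +
      ((64 * (m + 1) ^ 2 - 4 : ℤ) : GaussianInt) * padeGauss t m := by
    intro m
    have := padeRec_padeGauss t m
    push_cast
    exact this
  constructor <;> intro m
  · have h := congrArg Zsqrtd.re (key m)
    rw [Zsqrtd.re_add, Zsqrtd.re_smul, Zsqrtd.re_smul, Zsqrtd.re_smul] at h
    simp only [padeRe]
    exact_mod_cast h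
  · have h := congrArg Zsqrtd.im (key m)
    rw [Zsqrtd.im_add, Zsqrtd.im_smul, Zsqrtd.im_smul, Zsqrtd.im_smul] at h
    simp only [padeIm]
    exact_mod_cast h

theorem padeRe_zero (t : ℤ) : padeRe t 0 = 1 := by simp [padeRe, padeGauss_zero]
theorem padeIm_zero (t : ℤ) : padeIm t 0 = 0 := by simp [padeIm, padeGauss_zero]
theorem padeRe_one (t : ℤ) : padeRe t 1 = 2 * t := by simp [padeRe, padeGauss_one]
theorem padeIm_one (t : ℤ) : padeIm t 1 = 2 := by simp [padeIm, padeGauss_one]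

/-! ### Growth and Casoratians of solutions -/

section Rec

variable {t : ℝ} {u v : ℕ → ℝ}

theorem PadeRec.nonneg (h : PadeRec t u) (ht : 0 ≤ t) (h0 : 0 ≤ u 0) (h1 : 0 ≤ u 1) (n : ℕ) :
    0 ≤ u n := by
  suffices H : 0 ≤ u n ∧ 0 ≤ u (n + 1) from H.1
  induction n with
  | zero => exact ⟨h0, h1⟩
  | succ m ih =>
    refine ⟨ih.2, ?_⟩
    have hp : (0 : ℝ) < (m + 1) * (m + 2) := by positivity
    have hc : (0 : ℝ) ≤ 64 * ((m : ℝ) + 1) ^ 2 - 4 := by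
      nlinarith [(Nat.cast_nonneg m : (0 : ℝ) ≤ m)]
    refine nonneg_of_mul_nonneg_right ?_ hp
    rw [h m]
    have := ih.1
    have := ih.2
    positivity

theorem PadeRec.two_mul_le (h : PadeRec t u) (ht : 0 ≤ t) (h0 : 0 ≤ u 0) (h1 : 2 * t * u 0 ≤ u 1)
    (n : ℕ) : 2 * t * u n ≤ u (n + 1) := by
  have hn := h.nonneg ht h0 (h1.trans' (by positivity))
  rcases n with _ | m
  · exact h1
  · have hm : (0 : ℝ) ≤ m := Nat.cast_nonneg m
    have hp : (0 : ℝ) < (m + 1) * (m + 2) := by positivity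
    refine le_of_mul_le_mul_left ?_ hp
    rw [h m]
    have a1 : 0 ≤ ((m : ℝ) + 1) * (m + 1) * (2 * t * u (m + 1)) := by
      have := hn (m + 1); positivity
    have a2 : 0 ≤ (64 * ((m : ℝ) + 1) ^ 2 - 4) * u m :=
      mul_nonneg (by nlinarith) (hn m)
    linarith

/-- After division by (m + 1)(m + 2) the coefficients are at most 4t and 64, so a geometric sequence
with ratio a root of X² = 4tX + 64 dominates. -/
theorem PadeRec.le_mul_pow (h : PadeRec t u) (ht : 0 ≤ t) (h0 : 0 ≤ u 0) (h1 : 0 ≤ u 1)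
    {C x : ℝ} (hxt : x ^ 2 = 4 * t * x + 64) (hC0 : u 0 ≤ C) (hC1 : u 1 ≤ C * x)
    (n : ℕ) : u n ≤ C * x ^ n := by
  have hn := h.nonneg ht h0 h1
  suffices H : u n ≤ C * x ^ n ∧ u (n + 1) ≤ C * x ^ (n + 1) from H.1
  induction n with
  | zero => exact ⟨by simpa using hC0, by simpa using hC1⟩
  | succ m ih =>
    refine ⟨ih.2, ?_⟩
    have hm : (0 : ℝ) ≤ m := Nat.cast_nonneg m
    have hp : (0 : ℝ) < (m + 1) * (m + 2) := by positivity
    refine le_of_mul_le_mul_left ?_ hp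
    rw [h m]
    have e : C * x ^ (m + 1 + 1) = 4 * t * (C * x ^ (m + 1)) + 64 * (C * x ^ m) := by
      linear_combination C * x ^ m * hxt
    rw [e]
    have a1 : ((m : ℝ) + 1) * (m + 2) * (4 * t) * u (m + 1) ≤
        ((m : ℝ) + 1) * (m + 2) * (4 * t) * (C * x ^ (m + 1)) :=
      mul_le_mul_of_nonneg_left ih.2 (by positivity)
    have a2 : ((m : ℝ) + 1) * (m + 2) * 64 * u m ≤ ((m : ℝ) + 1) * (m + 2) * 64 * (C * x ^ m) :=
      mul_le_mul_of_nonneg_left ih.1 (by positivity)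
    have a3 : 0 ≤ ((m : ℝ) + 1) * (2 * t) * u (m + 1) := by have := hn (m + 1); positivity
    have a4 : 0 ≤ (64 * ((m : ℝ) + 1) + 4) * u m := by have := hn m; positivity
    linarith

/-- For n·u(n) the normalised coefficients are instead at least 4t and 64. The lost factor n is
regained from the Casoratian bound. -/
theorem PadeRec.pow_le_mul (h : PadeRec t u) (ht : 0 ≤ t) (h0 : 0 ≤ u 0) (h1 : 0 ≤ u 1)
    {c x : ℝ} (hxt : x ^ 2 = 4 * t * x + 64) (hc1 : c * x ≤ u 1)
    (hc2 : c * x ^ 2 ≤ 2 * u 2) (n : ℕ) : c * x ^ (n + 1) ≤ (n + 1) * u (n + 1) := by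
  have hn := h.nonneg ht h0 h1
  suffices H : c * x ^ (n + 1) ≤ (n + 1) * u (n + 1) ∧ c * x ^ (n + 2) ≤ (n + 2) * u (n + 2) from H.1
  induction n with
  | zero => exact ⟨by simpa using hc1, by simpa using hc2⟩
  | succ m ih =>
    have hm : (0 : ℝ) ≤ m := Nat.cast_nonneg m
    have hr := h (m + 1)
    push_cast at hr ⊢
    refine ⟨by linarith [ih.2], ?_⟩
    have hp : (0 : ℝ) < m + 2 := by positivity
    refine le_of_mul_le_mul_left ?_ hp
    have e : c * x ^ (m + 1 + 2) = 4 * t * (c * x ^ (m + 2)) + 64 * (c * x ^ (m + 1)) := by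
      linear_combination c * x ^ (m + 1) * hxt
    rw [e]
    have a1 : ((m : ℝ) + 2) * (4 * t) * (c * x ^ (m + 2)) ≤
        ((m : ℝ) + 2) * (4 * t) * ((m + 2) * u (m + 2)) :=
      mul_le_mul_of_nonneg_left ih.2 (by positivity)
    have a2 : ((m : ℝ) + 2) * 64 * (c * x ^ (m + 1)) ≤
        ((m : ℝ) + 2) * 64 * ((m + 1) * u (m + 1)) :=
      mul_le_mul_of_nonneg_left ih.1 (by positivity)
    have a3 : 0 ≤ ((m : ℝ) + 2) * (2 * t) * u (m + 2) := by have := hn (m + 2); positivity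
    have a4 : 0 ≤ (64 * ((m : ℝ) + 2) - 4) * u (m + 1) :=
      mul_nonneg (by linarith) (hn (m + 1))
    have e1 : m + 1 + 2 = m + 3 := rfl
    have e2 : m + 1 + 1 = m + 2 := rfl
    rw [e1, e2] at hr
    rw [e1]
    linarith

theorem PadeRec.det_succ (hu : PadeRec t u) (hv : PadeRec t v) (m : ℕ) :
    ((m : ℝ) + 1) * (m + 2) * (v (m + 2) * u (m + 1) - v (m + 1) * u (m + 2)) =
      -((64 * (m + 1) ^ 2 - 4) * (v (m + 1) * u m - v m * u (m + 1))) := by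
  linear_combination u (m + 1) * hv m - v (m + 1) * hu m

theorem PadeRec.det_ne_zero (hu : PadeRec t u) (hv : PadeRec t v)
    (h0 : v 1 * u 0 - v 0 * u 1 ≠ 0) (n : ℕ) : v (n + 1) * u n - v n * u (n + 1) ≠ 0 := by
  induction n with
  | zero => exact h0
  | succ m ih =>
    intro H
    have h := hu.det_succ hv m
    rw [H, mul_zero, zero_eq_neg] at h
    rcases mul_eq_zero.1 h with h | h
    · nlinarith [(Nat.cast_nonneg m : (0 : ℝ) ≤ m)]
    · exact ih h

theorem PadeRec.abs_det_succ_le (hu : PadeRec t u) (hv : PadeRec t v) (m : ℕ) :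
    ((m : ℝ) + 2) * |v (m + 2) * u (m + 1) - v (m + 1) * u (m + 2)| ≤
      64 * ((m + 1) * |v (m + 1) * u m - v m * u (m + 1)|) := by
  have h := congrArg abs (hu.det_succ hv m)
  have hm : (0 : ℝ) ≤ m := Nat.cast_nonneg m
  have hc : (0 : ℝ) ≤ 64 * ((m : ℝ) + 1) ^ 2 - 4 := by nlinarith
  rw [abs_neg, abs_mul, abs_mul (_ - _) (_ - _), abs_of_nonneg hc,
    abs_of_nonneg (by positivity : (0 : ℝ) ≤ ((m : ℝ) + 1) * (m + 2))] at h
  have hp : (0 : ℝ) < m + 1 := by positivity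
  refine le_of_mul_le_mul_left ?_ hp
  have := abs_nonneg (v (m + 1) * u m - v m * u (m + 1))
  linarith

/-- The product of the step ratios, each at most 64(m + 1)/(m + 2), telescopes. -/
theorem PadeRec.abs_det_le (hu : PadeRec t u) (hv : PadeRec t v) (n : ℕ) :
    ((n : ℝ) + 1) * |v (n + 1) * u n - v n * u (n + 1)| ≤ |v 1 * u 0 - v 0 * u 1| * 64 ^ n := by
  induction n with
  | zero => simp
  | succ m ih =>
    have := hu.abs_det_succ_le hv m
    push_cast
    rw [pow_succ]
    linarith

/-- The distance of a convergent `v n / u n` to the limit is controlled by the next step. -/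
theorem PadeRec.abs_sub_le (hu : PadeRec t u) (hv : PadeRec t v) (ht : 128 ≤ t) (h0 : 0 < u 0)
    (h1 : 2 * t * u 0 ≤ u 1) {T : ℝ} (hT : Tendsto (fun n => v n / u n) atTop (𝓝 T)) (n : ℕ) :
    |u n * T - v n| ≤ 1.002 * |v (n + 1) * u n - v n * u (n + 1)| / u (n + 1) := by
  have hle := hu.two_mul_le (by linarith) h0.le h1
  have hpos : ∀ n, 0 < u n := by
    intro n
    induction n with
    | zero => exact h0
    | succ m ih => exact (hle m).trans_lt' (by nlinarith)
  set g : ℕ → ℝ := fun n => |v (n + 1) * u n - v n * u (n + 1)| / (u n * u (n + 1)) with hg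
  have hstep : ∀ n, dist (v n / u n) (v (n + 1) / u (n + 1)) = g n := by
    intro n
    have e : v n / u n - v (n + 1) / u (n + 1) =
        -(v (n + 1) * u n - v n * u (n + 1)) / (u n * u (n + 1)) := by
      have := (hpos n).ne'
      have := (hpos (n + 1)).ne'
      field_simp
      ring
    rw [Real.dist_eq, e, abs_div, abs_neg, abs_of_pos (mul_pos (hpos n) (hpos (n + 1)))]
  -- Each step multiplies the Casoratian by at most 64, while two steps multiply u by at least 256²
  -- > 64000.
  have hratio : ∀ n, g (n + 1) ≤ g n * (1 / 1000) := by
    intro n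
    have hd : |v (n + 2) * u (n + 1) - v (n + 1) * u (n + 2)| ≤
        64 * |v (n + 1) * u n - v n * u (n + 1)| := by
      have h := hu.abs_det_succ_le hv n
      have hp : (0 : ℝ) < n + 2 := by positivity
      refine le_of_mul_le_mul_left ?_ hp
      have := abs_nonneg (v (n + 1) * u n - v n * u (n + 1))
      linarith
    have p0 := hpos n
    have p1 := hpos (n + 1)
    have p2 := hpos (n + 2)
    have hu2 : 64000 * u n ≤ u (n + 2) := by
      have a := hle n
      have b : 2 * t * u (n + 1) ≤ u (n + 2) := hle (n + 1)
      have a' : 256 * u n ≤ u (n + 1) := a.trans' (by nlinarith)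
      have b' : 256 * u (n + 1) ≤ u (n + 2) := b.trans' (by nlinarith)
      linarith
    simp only [hg]
    rw [div_mul_eq_mul_div, div_le_div_iff₀ (by positivity) (by positivity)]
    have hab := abs_nonneg (v (n + 1) * u n - v n * u (n + 1))
    calc |v (n + 2) * u (n + 1) - v (n + 1) * u (n + 2)| * (u n * u (n + 1))
        ≤ 64 * |v (n + 1) * u n - v n * u (n + 1)| * (u n * u (n + 1)) := by gcongr
      _ = |v (n + 1) * u n - v n * u (n + 1)| * (1 / 1000) * (u (n + 1) * (64000 * u n)) := by ring
      _ ≤ _ := by gcongr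
  have hgeo : ∀ k, dist (v (n + k) / u (n + k)) (v (n + (k + 1)) / u (n + (k + 1))) ≤
      g n * (1 / 1000) ^ k := by
    intro k
    rw [← add_assoc, hstep]
    induction k with
    | zero => simp
    | succ k ih =>
      refine (hratio (n + k)).trans ?_
      rw [pow_succ]
      linarith
  have hT' : Tendsto (fun k => v (n + k) / u (n + k)) atTop (𝓝 T) := by
    have := (tendsto_add_atTop_iff_nat n).2 hT
    simpa only [add_comm] using this
  have h := dist_le_of_le_geometric_of_tendsto₀ (1 / 1000) (g n) (by norm_num) hgeo hT'
  have p0 := hpos n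
  have p1 := hpos (n + 1)
  have e : u n * T - v n = -(u n * (v n / u n - T)) := by field_simp; ring
  rw [Real.dist_eq, add_zero] at h
  rw [e, abs_neg, abs_mul, abs_of_pos p0]
  calc u n * |v n / u n - T| ≤ u n * (g n / (1 - 1 / 1000)) := by gcongr
    _ = (1000 / 999) * (|v (n + 1) * u n - v n * u (n + 1)| / u (n + 1)) := by
        simp only [hg]
        field_simp
        norm_num
    _ ≤ 1.002 * (|v (n + 1) * u n - v n * u (n + 1)| / u (n + 1)) := by
        gcongr
        norm_num
    _ = _ := by rw [mul_div_assoc]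

end Rec

/-! ### Hermite's integrals -/

/-- The segment from `t - 4i` to `t + 4i`. -/
noncomputable def seg (t x : ℝ) : ℂ := (t : ℂ) + (8 * (x : ℂ) - 4) * Complex.I

theorem seg_re (t x : ℝ) : (seg t x).re = t := by simp [seg]

theorem seg_mem_slitPlane {t : ℝ} (ht : 0 < t) (x : ℝ) : seg t x ∈ Complex.slitPlane :=
  Or.inl (by rwa [seg_re])

theorem hasDerivAt_coe_complex (x : ℝ) : HasDerivAt (fun x : ℝ => (x : ℂ)) 1 x := by
  simpa using (hasDerivAt_id x).ofReal_comp

theorem hasDerivAt_seg (t x : ℝ) : HasDerivAt (seg t) (8 * Complex.I) x := by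
  have h := (hasDerivAt_coe_complex x).const_mul (8 : ℂ)
  have h2 := ((h.sub_const 4).mul_const Complex.I).const_add (t : ℂ)
  exact h2.congr_deriv (by ring)

theorem continuous_seg (t : ℝ) : Continuous (seg t) := by
  unfold seg
  fun_prop

theorem seg_cpow_succ {t : ℝ} (ht : 0 < t) (x : ℝ) (s : ℂ) :
    seg t x ^ (s + 1) = seg t x ^ s * seg t x := by
  rw [Complex.cpow_add _ _ (Complex.slitPlane_ne_zero (seg_mem_slitPlane ht x)), Complex.cpow_one]

theorem continuous_seg_cpow {t : ℝ} (ht : 0 < t) (s : ℂ) : Continuous fun x => seg t x ^ s :=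
  (continuous_seg t).cpow continuous_const (seg_mem_slitPlane ht)

theorem hasDerivAt_seg_cpow {t : ℝ} (ht : 0 < t) (x : ℝ) (s : ℂ) :
    HasDerivAt (fun x => seg t x ^ s) (s * seg t x ^ (s - 1) * (8 * Complex.I)) x := by
  have h := (hasDerivAt_id (seg t x)).cpow_const (c := s) (seg_mem_slitPlane ht x)
  have h2 := h.comp x (hasDerivAt_seg t x)
  simpa [Function.comp_def] using h2

/-- The integrals of Hermite for the remainders of the Padé approximants. -/
noncomputable def hermiteInt (t : ℝ) (n : ℕ) : ℂ :=
  ∫ x in (0 : ℝ)..1, ((x : ℂ) * (1 - x)) ^ n * seg t x ^ (1 / 4 - ((n : ℂ) + 1))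

theorem hermiteInt_continuous {t : ℝ} (ht : 0 < t) (n : ℕ) (s : ℂ) :
    Continuous fun x : ℝ => ((x : ℂ) * (1 - x)) ^ n * seg t x ^ s :=
  (by fun_prop : Continuous fun x : ℝ => ((x : ℂ) * (1 - x)) ^ n).mul (continuous_seg_cpow ht s)

theorem hasDerivAt_mul_one_sub (x : ℝ) :
    HasDerivAt (fun x : ℝ => (x : ℂ) * (1 - x)) (1 - 2 * (x : ℂ)) x := by
  have h := hasDerivAt_coe_complex x
  have h2 := h.fun_mul (h.const_sub 1)
  exact h2.congr_deriv (by ring)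

/-- The polynomial factor of the primitive that yields the recurrence for `hermiteInt`. -/
noncomputable def certPoly (t : ℝ) (n : ℂ) (x : ℝ) : ℂ :=
  (n + 1) * (t - 4 * Complex.I - 2 * t * x) + 8 * Complex.I * (n + 3 / 4) * ((x : ℂ) * (1 - x))

theorem hasDerivAt_certPoly (t : ℝ) (n : ℂ) (x : ℝ) :
    HasDerivAt (certPoly t n)
      (-(n + 1) * (2 * t) + 8 * Complex.I * (n + 3 / 4) * (1 - 2 * (x : ℂ))) x := by
  have h := hasDerivAt_coe_complex x
  have h2 := (((h.const_mul (2 * (t : ℂ))).const_sub (t - 4 * Complex.I)).const_mul (n + 1)).fun_add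
    ((hasDerivAt_mul_one_sub x).const_mul (8 * Complex.I * (n + 3 / 4)))
  exact h2.congr_deriv (by ring)

/-- Creative telescoping: this combination of integrands is the derivative of a function with the
factor (x(1 - x))^(m + 1), which vanishes at both endpoints. -/
theorem hermiteInt_rec {t : ℝ} (ht : 0 < t) (m : ℕ) :
    ((m + 2 : ℂ) ^ 2 - 1 / 16) * (-64) * hermiteInt t (m + 2) =
      (2 * m + 3) * (m + 2) * (2 * t) * hermiteInt t (m + 1) -
        (m + 1) * (m + 2) * hermiteInt t m := by
  set s : ℂ := 1 / 4 - ((m : ℂ) + 3) with hs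
  have hd : ∀ x ∈ Set.uIcc (0 : ℝ) 1, HasDerivAt
      (fun x : ℝ => ((x : ℂ) * (1 - x)) ^ (m + 1) * seg t x ^ (s + 1) * certPoly t (m + 1) x)
      (((m + 2 : ℂ) ^ 2 - 1 / 16) * (-64) * (((x : ℂ) * (1 - x)) ^ (m + 2) * seg t x ^ s) -
        (2 * m + 3) * (m + 2) * (2 * t) * (((x : ℂ) * (1 - x)) ^ (m + 1) * seg t x ^ (s + 1)) +
        (m + 1) * (m + 2) * (((x : ℂ) * (1 - x)) ^ m * seg t x ^ (s + 1 + 1))) x := by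
    intro x _
    have h := ((((hasDerivAt_mul_one_sub x).fun_pow (m + 1)).fun_mul
      (hasDerivAt_seg_cpow ht x (s + 1))).fun_mul (hasDerivAt_certPoly t (m + 1) x))
    refine h.congr_deriv ?_
    simp only [seg_cpow_succ ht, add_sub_cancel_right, Nat.add_sub_cancel]
    have hI : Complex.I ^ 2 = -1 := Complex.I_sq
    generalize seg t x ^ s = Z
    rw [certPoly, seg, hs]
    push_cast
    generalize Complex.I = i at *
    generalize (x : ℂ) = x
    generalize (t : ℂ) = t
    generalize (m : ℂ) = m'
    linear_combination Z * (x * (1 - x)) ^ m * x ^ 2 * (1 - x) ^ 2 *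
      (64 * m' ^ 2 + 256 * m' + 252) * hI
  have hc : ∀ (n : ℕ) (s : ℂ), IntervalIntegrable (fun x : ℝ => ((x : ℂ) * (1 - x)) ^ n * seg t x ^ s)
      MeasureTheory.volume 0 1 := fun n s => (hermiteInt_continuous ht n s).intervalIntegrable _ _
  have hF := intervalIntegral.integral_eq_sub_of_hasDerivAt hd
    ((((hc _ _).const_mul _).sub ((hc _ _).const_mul _)).add ((hc _ _).const_mul _))
  rw [intervalIntegral.integral_add (((hc _ _).const_mul _).sub ((hc _ _).const_mul _))
    ((hc _ _).const_mul _), intervalIntegral.integral_sub ((hc _ _).const_mul _)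
    ((hc _ _).const_mul _), intervalIntegral.integral_const_mul,
    intervalIntegral.integral_const_mul, intervalIntegral.integral_const_mul] at hF
  have e0 : (1 / 4 - ((m : ℂ) + 1)) = s + 1 + 1 := by rw [hs]; ring
  have e1 : (1 / 4 - (((m + 1 : ℕ) : ℂ) + 1)) = s + 1 := by rw [hs]; push_cast; ring
  have e2 : (1 / 4 - (((m + 2 : ℕ) : ℂ) + 1)) = s := by rw [hs]; push_cast; ring
  simp only [hermiteInt, e0, e1, e2]
  simp at hF
  linear_combination hF

theorem seg_zero (t : ℝ) : seg t 0 = t - 4 * Complex.I := by simp [seg]; ring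
theorem seg_one (t : ℝ) : seg t 1 = t + 4 * Complex.I := by simp [seg]; ring

theorem hermiteInt_zero {t : ℝ} (ht : 0 < t) :
    2 * Complex.I * hermiteInt t 0 =
      (t + 4 * Complex.I) ^ (1 / 4 : ℂ) - (t - 4 * Complex.I) ^ (1 / 4 : ℂ) := by
  have hd : ∀ x ∈ Set.uIcc (0 : ℝ) 1, HasDerivAt (fun x : ℝ => seg t x ^ (1 / 4 : ℂ))
      (2 * Complex.I * (((x : ℂ) * (1 - x)) ^ 0 * seg t x ^ (1 / 4 - (((0 : ℕ) : ℂ) + 1)))) x := by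
    intro x _
    convert hasDerivAt_seg_cpow ht x (1 / 4) using 1
    simp
    ring
  have hF := intervalIntegral.integral_eq_sub_of_hasDerivAt hd
    (((hermiteInt_continuous ht 0 _).intervalIntegrable _ _).const_mul _)
  rw [intervalIntegral.integral_const_mul] at hF
  rw [hermiteInt, hF, seg_zero, seg_one]

/-- The same primitive without the vanishing factor: `certPoly t 0` equals `seg t 0` at 0 and `-seg
t 1` at 1, so the boundary terms are fourth roots. -/
theorem hermiteInt_one {t : ℝ} (ht : 0 < t) :
    -60 * hermiteInt t 1 = 2 * t * hermiteInt t 0 -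
      ((t + 4 * Complex.I) ^ (1 / 4 : ℂ) + (t - 4 * Complex.I) ^ (1 / 4 : ℂ)) := by
  set s : ℂ := 1 / 4 - 2 with hs
  have hd : ∀ x ∈ Set.uIcc (0 : ℝ) 1, HasDerivAt
      (fun x : ℝ => seg t x ^ (s + 1) * certPoly t 0 x)
      (-60 * (((x : ℂ) * (1 - x)) ^ 1 * seg t x ^ s) -
        2 * t * (((x : ℂ) * (1 - x)) ^ 0 * seg t x ^ (s + 1))) x := by
    intro x _
    have h := (hasDerivAt_seg_cpow ht x (s + 1)).fun_mul (hasDerivAt_certPoly t 0 x)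
    refine h.congr_deriv ?_
    simp only [seg_cpow_succ ht, add_sub_cancel_right]
    have hI : Complex.I ^ 2 = -1 := Complex.I_sq
    generalize seg t x ^ s = Z
    rw [certPoly, seg, hs]
    generalize Complex.I = i at *
    generalize (x : ℂ) = x
    generalize (t : ℂ) = t
    linear_combination 60 * Z * x * (1 - x) * hI
  have hc : ∀ (n : ℕ) (s : ℂ), IntervalIntegrable (fun x : ℝ => ((x : ℂ) * (1 - x)) ^ n * seg t x ^ s)
      MeasureTheory.volume 0 1 := fun n s => (hermiteInt_continuous ht n s).intervalIntegrable _ _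
  have hF := intervalIntegral.integral_eq_sub_of_hasDerivAt hd
    (((hc _ _).const_mul _).sub ((hc _ _).const_mul _))
  rw [intervalIntegral.integral_sub ((hc _ _).const_mul _)
    ((hc _ _).const_mul _), intervalIntegral.integral_const_mul,
    intervalIntegral.integral_const_mul] at hF
  have e0 : (1 / 4 - (((0 : ℕ) : ℂ) + 1)) = s + 1 := by rw [hs]; push_cast; ring
  have e1 : (1 / 4 - (((1 : ℕ) : ℂ) + 1)) = s := by rw [hs]; push_cast; ring
  have e2 : (1 / 4 : ℂ) = s + 1 + 1 := by rw [hs]; ring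
  have hs0 := seg_cpow_succ ht 0 (s + 1)
  have hs1 := seg_cpow_succ ht 1 (s + 1)
  rw [seg_zero, ← e2] at hs0
  rw [seg_one, ← e2] at hs1
  simp only [certPoly, seg_zero, seg_one, Complex.ofReal_zero, Complex.ofReal_one] at hF
  simp only [hermiteInt, e0, e1]
  linear_combination hF + hs0 + hs1

theorem norm_hermiteInt_le {t : ℝ} (ht : 1 ≤ t) (n : ℕ) : ‖hermiteInt t n‖ ≤ (1 / 4) ^ n := by
  have h : ∀ x ∈ Set.uIoc (0 : ℝ) 1,
      ‖((x : ℂ) * (1 - x)) ^ n * seg t x ^ (1 / 4 - ((n : ℂ) + 1))‖ ≤ (1 / 4) ^ n := by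
    intro x hx
    rw [Set.uIoc_of_le zero_le_one] at hx
    have h1 : ‖(x : ℂ) * (1 - x)‖ ≤ 1 / 4 := by
      have : (x : ℂ) * (1 - x) = ((x * (1 - x) : ℝ) : ℂ) := by push_cast; ring
      rw [this, Complex.norm_real, Real.norm_of_nonneg (mul_nonneg hx.1.le (by linarith [hx.2]))]
      nlinarith [sq_nonneg (x - 1 / 2)]
    have h2 : ‖seg t x ^ (1 / 4 - ((n : ℂ) + 1))‖ ≤ 1 := by
      have hs := seg_mem_slitPlane (by linarith : 0 < t) x
      rw [Complex.norm_cpow_of_ne_zero (Complex.slitPlane_ne_zero hs)]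
      have him : (1 / 4 - ((n : ℂ) + 1)).im = 0 := by simp
      have hre : (1 / 4 - ((n : ℂ) + 1)).re = 1 / 4 - ((n : ℝ) + 1) := by simp
      rw [him, hre, mul_zero, Real.exp_zero, div_one]
      refine Real.rpow_le_one_of_one_le_of_nonpos ?_ ?_
      · have := Complex.re_le_norm (seg t x)
        rw [seg_re] at this
        linarith
      · linarith [(Nat.cast_nonneg n : (0 : ℝ) ≤ n)]
    rw [norm_mul, norm_pow]
    calc _ ≤ (1 / 4 : ℝ) ^ n * 1 := by gcongr
      _ = _ := mul_one _
  simpa [hermiteInt] using intervalIntegral.norm_integral_le_of_norm_le_const h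

/-! ### Padé remainders and the limit of the approximations -/

/-- The normalising factors of the remainders. -/
noncomputable def remConst : ℕ → ℝ
  | 0 => 1 / 4
  | n + 1 => remConst n * (1 - 1 / (16 * ((n : ℝ) + 1) ^ 2))

theorem remConst_mem (n : ℕ) : 0 ≤ remConst n ∧ remConst n ≤ 1 / 4 := by
  induction n with
  | zero => norm_num [remConst]
  | succ m ih =>
    have hm : (0 : ℝ) ≤ m := Nat.cast_nonneg m
    have h1 : (0 : ℝ) ≤ 1 / (16 * ((m : ℝ) + 1) ^ 2) := by positivity
    have h2 : 1 / (16 * ((m : ℝ) + 1) ^ 2) ≤ 1 := by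
      rw [div_le_one (by positivity)]
      nlinarith
    rw [remConst]
    constructor <;> nlinarith

/-- The remainders of the Padé approximants. -/
noncomputable def padeRem (t : ℝ) (n : ℕ) : ℂ :=
  remConst n * (8 * Complex.I) ^ (2 * n + 1) * hermiteInt t n

theorem norm_padeRem_le {t : ℝ} (ht : 1 ≤ t) (n : ℕ) : ‖padeRem t n‖ ≤ 2 * 16 ^ n := by
  obtain ⟨h0, h1⟩ := remConst_mem n
  rw [padeRem, norm_mul, norm_mul, norm_pow, Complex.norm_real, Real.norm_of_nonneg h0]
  have : ‖8 * Complex.I‖ = 8 := by simp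
  rw [this]
  calc _ ≤ 1 / 4 * 8 ^ (2 * n + 1) * (1 / 4 : ℝ) ^ n := by
        gcongr
        exact norm_hermiteInt_le ht n
    _ = 2 * (8 ^ 2 * (1 / 4)) ^ n := by rw [mul_pow, ← pow_mul, pow_succ]; ring
    _ = _ := by norm_num

theorem padeRec_padeRem {t : ℝ} (ht : 0 < t) : PadeRec (t : ℂ) (padeRem t) := by
  intro m
  have h := hermiteInt_rec ht m
  have hm1 : (m : ℂ) + 1 ≠ 0 := by exact_mod_cast m.succ_ne_zero
  have hm2 : (m : ℂ) + 2 ≠ 0 := by exact_mod_cast (m + 1).succ_ne_zero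
  have hI : (8 * Complex.I) ^ 2 = -64 := by rw [mul_pow, Complex.I_sq]; norm_num
  have c1 : (remConst (m + 1) : ℂ) * (m + 1) ^ 2 = remConst m * ((m + 1) ^ 2 - 1 / 16) := by
    rw [remConst]
    push_cast
    field_simp
  have c2 : (remConst (m + 2) : ℂ) * (m + 2) ^ 2 =
      remConst (m + 1) * ((m + 2) ^ 2 - 1 / 16) := by
    have e : ((m + 1 : ℕ) : ℝ) + 1 = m + 2 := by push_cast; ring
    rw [remConst, e]
    push_cast
    field_simp
  have p2 : (8 * Complex.I) ^ (2 * (m + 2) + 1) = 4096 * (8 * Complex.I) ^ (2 * m + 1) := by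
    calc _ = (8 * Complex.I) ^ (2 * m + 1) * ((8 * Complex.I) ^ 2) ^ 2 := by ring
      _ = _ := by rw [hI]; ring
  have p1 : (8 * Complex.I) ^ (2 * (m + 1) + 1) = -64 * (8 * Complex.I) ^ (2 * m + 1) := by
    calc _ = (8 * Complex.I) ^ (2 * m + 1) * (8 * Complex.I) ^ 2 := by ring
      _ = _ := by rw [hI]; ring
  simp only [padeRem, p1, p2]
  generalize (8 * Complex.I) ^ (2 * m + 1) = P
  apply mul_left_cancel₀ hm2
  linear_combination (4096 * (m + 1) * P * hermiteInt t (m + 2)) * c2 -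
    64 * P * (m + 1) * remConst (m + 1) * h +
    (64 * P * (m + 2) * hermiteInt t m) * c1

theorem PadeRec.eq_of_eq {t : ℂ} {u v : ℕ → ℂ} (hu : PadeRec t u) (hv : PadeRec t v)
    (h0 : u 0 = v 0) (h1 : u 1 = v 1) (n : ℕ) : u n = v n := by
  suffices H : u n = v n ∧ u (n + 1) = v (n + 1) from H.1
  induction n with
  | zero => exact ⟨h0, h1⟩
  | succ m ih =>
    refine ⟨ih.2, ?_⟩
    have hm1 : (m : ℂ) + 1 ≠ 0 := by exact_mod_cast m.succ_ne_zero
    have hm2 : (m : ℂ) + 2 ≠ 0 := by exact_mod_cast (m + 1).succ_ne_zero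
    apply mul_left_cancel₀ (mul_ne_zero hm1 hm2)
    rw [hu m, hv m, ih.1, ih.2]

/-- Both sides solve the same recurrence, so agreement at n = 0 and n = 1 suffices. -/
theorem padeRem_eq {t : ℤ} (ht : 0 < t) (n : ℕ) :
    padeRem t n = ((t : ℂ) + 4 * Complex.I) ^ (1 / 4 : ℂ) * (padeRe t n - padeIm t n * Complex.I) -
      ((t : ℂ) - 4 * Complex.I) ^ (1 / 4 : ℂ) * (padeRe t n + padeIm t n * Complex.I) := by
  have htr : (0 : ℝ) < t := by exact_mod_cast ht
  have h0 := hermiteInt_zero htr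
  have h1 := hermiteInt_one htr
  obtain ⟨hre, him⟩ := padeRec_re_im t
  simp only [Complex.ofReal_intCast] at h0 h1
  refine PadeRec.eq_of_eq (v := fun n => ((t : ℂ) + 4 * Complex.I) ^ (1 / 4 : ℂ) *
    (padeRe t n - padeIm t n * Complex.I) -
      ((t : ℂ) - 4 * Complex.I) ^ (1 / 4 : ℂ) * (padeRe t n + padeIm t n * Complex.I))
    (padeRec_padeRem htr) ?_ ?_ ?_ n
  · intro m
    have hr := congrArg Complex.ofReal (hre m)
    have hi := congrArg Complex.ofReal (him m)
    push_cast at hr hi ⊢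
    generalize ((t : ℂ) + 4 * Complex.I) ^ (1 / 4 : ℂ) = a
    generalize ((t : ℂ) - 4 * Complex.I) ^ (1 / 4 : ℂ) = b
    linear_combination (a - b) * hr - (a + b) * Complex.I * hi
  · simp only [padeRe_zero, padeIm_zero, padeRem, remConst]
    push_cast
    linear_combination h0
  · simp only [padeRe_one, padeIm_one, padeRem, remConst]
    push_cast
    linear_combination (2 * (t : ℂ)) * h0 + 2 * Complex.I * h1 + (120 * hermiteInt t 1 * Complex.I) * Complex.I_sq

theorem cpow_quarter_conj {t : ℝ} (ht : 0 < t) :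
    ((t : ℂ) - 4 * Complex.I) ^ (1 / 4 : ℂ) =
      (starRingEnd ℂ) (((t : ℂ) + 4 * Complex.I) ^ (1 / 4 : ℂ)) := by
  have harg : ((t : ℂ) + 4 * Complex.I).arg ≠ Real.pi := by
    refine Complex.slitPlane_arg_ne_pi (Or.inl ?_)
    simpa using ht
  have h := Complex.conj_cpow ((t : ℂ) + 4 * Complex.I) (1 / 4) harg
  have e1 : (starRingEnd ℂ) ((t : ℂ) + 4 * Complex.I) = (t : ℂ) - 4 * Complex.I := by
    simp [sub_eq_add_neg, map_ofNat]
  have e2 : (starRingEnd ℂ) (1 / 4 : ℂ) = 1 / 4 := by simp [map_ofNat]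
  rw [e1, e2] at h
  exact h

/-- As the two fourth roots are conjugate, the remainder is 2i times the quantity bounded here. -/
theorem abs_padeRe_mul_sub_le {t : ℤ} (ht : 0 < t) (n : ℕ) :
    |(((t : ℂ) + 4 * Complex.I) ^ (1 / 4 : ℂ)).im * padeRe t n -
      (((t : ℂ) + 4 * Complex.I) ^ (1 / 4 : ℂ)).re * padeIm t n| ≤ 16 ^ n := by
  have htr : (1 : ℝ) ≤ t := by exact_mod_cast ht
  have h := padeRem_eq ht n
  have hc := cpow_quarter_conj (t := t) (by linarith)
  rw [Complex.ofReal_intCast] at hc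
  rw [hc] at h
  have hn := norm_padeRem_le htr n
  set g := ((t : ℂ) + 4 * Complex.I) ^ (1 / 4 : ℂ)
  have e : padeRem t n = ((2 * (g.im * padeRe t n - g.re * padeIm t n) : ℝ) : ℂ) * Complex.I := by
    rw [h]
    apply Complex.ext
    · simp
    · simp; ring
  rw [e, norm_mul, Complex.norm_I, mul_one, Complex.norm_real, Real.norm_eq_abs, abs_mul, abs_two]
    at hn
  linarith

theorem cpow_quarter_re_im {t : ℝ} (ht : 0 < t) :
    0 < (((t : ℂ) + 4 * Complex.I) ^ (1 / 4 : ℂ)).re ∧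
    0 ≤ (((t : ℂ) + 4 * Complex.I) ^ (1 / 4 : ℂ)).im ∧
    (((t : ℂ) + 4 * Complex.I) ^ (1 / 4 : ℂ)).im ≤ (((t : ℂ) + 4 * Complex.I) ^ (1 / 4 : ℂ)).re := by
  set z : ℂ := (t : ℂ) + 4 * Complex.I with hz
  have hre : z.re = t := by simp [hz]
  have him : z.im = 4 := by simp [hz]
  have hz0 : z ≠ 0 := by
    intro h
    rw [h] at him
    norm_num at him
  have ha0 : 0 ≤ z.arg := Complex.arg_nonneg_iff.2 (by rw [him]; norm_num)
  have ha1 : z.arg ≤ Real.pi / 2 := Complex.arg_le_pi_div_two_iff.2 (Or.inl (by rw [hre]; exact ht.le))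
  have hpi := Real.pi_pos
  rw [Complex.cpow_def_of_ne_zero hz0]
  have e1 : (Complex.log z * (1 / 4)).im = z.arg / 4 := by
    simp [Complex.mul_im, Complex.log_im]
    ring
  rw [Complex.exp_re, Complex.exp_im, e1]
  have hE := Real.exp_pos (Complex.log z * (1 / 4)).re
  have hs : 0 ≤ Real.sin (z.arg / 4) := Real.sin_nonneg_of_nonneg_of_le_pi (by linarith) (by linarith)
  have hcos : 0 < Real.cos (z.arg / 4) := Real.cos_pos_of_mem_Ioo ⟨by linarith, by linarith⟩
  refine ⟨by positivity, by positivity, mul_le_mul_of_nonneg_left ?_ hE.le⟩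
  calc Real.sin (z.arg / 4) ≤ Real.sin (Real.pi / 4) :=
        Real.sin_le_sin_of_le_of_le_pi_div_two (by linarith) (by linarith) (by linarith)
    _ = Real.cos (Real.pi / 4) := by rw [Real.sin_pi_div_four, Real.cos_pi_div_four]
    _ ≤ Real.cos (z.arg / 4) :=
        Real.cos_le_cos_of_nonneg_of_le_pi (by linarith) (by linarith) (by linarith)

theorem two_mul_pow_le_padeRe {t : ℤ} (ht : 0 < t) (n : ℕ) : (2 * (t : ℝ)) ^ n ≤ padeRe t n := by
  have htr : (0 : ℝ) < t := by exact_mod_cast ht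
  induction n with
  | zero => simp [padeRe_zero]
  | succ m ih =>
    have h := (padeRec_re_im t).1.two_mul_le htr.le (by simp [padeRe_zero])
      (by simp [padeRe_zero, padeRe_one]) m
    refine h.trans' ?_
    rw [pow_succ']
    gcongr

theorem rho_sq (t : ℤ) : rho t ^ 2 = 1 + eps t ^ 2 := Real.sq_sqrt (by positivity)

theorem one_lt_rho (t : ℤ) : 1 < rho t := by
  have h := rho_sq t
  have h1 := eps_pos t
  have h2 : 0 ≤ rho t := Real.sqrt_nonneg _
  nlinarith

theorem eps_lt_rho (t : ℤ) : eps t < rho t := by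
  have h := rho_sq t
  have h1 := eps_pos t
  have h2 := one_lt_rho t
  nlinarith

theorem tendsto_padeIm_div_padeRe {t : ℤ} (ht : 128 ≤ t) :
    Tendsto (fun n => padeIm t n / padeRe t n) atTop (𝓝 (-(eps t - rho t))) := by
  have htr : (128 : ℝ) ≤ t := by exact_mod_cast ht
  have ht0 : 0 < t := by omega
  obtain ⟨ha, hb, hab⟩ := cpow_quarter_re_im (t := t) (by linarith)
  have hbound := abs_padeRe_mul_sub_le ht0
  have hg4 : (((t : ℂ) + 4 * Complex.I) ^ (1 / 4 : ℂ)) ^ 4 = (t : ℂ) + 4 * Complex.I := by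
    have := Complex.cpow_nat_inv_pow ((t : ℂ) + 4 * Complex.I) (n := 4) (by norm_num)
    rw [one_div]
    exact_mod_cast this
  rw [Complex.ofReal_intCast] at ha hb hab
  set g := ((t : ℂ) + 4 * Complex.I) ^ (1 / 4 : ℂ)
  set a := g.re with ha'
  set b := g.im with hb'
  have hlim : Tendsto (fun n => padeIm t n / padeRe t n) atTop (𝓝 (b / a)) := by
    have hz : Tendsto (fun n : ℕ => a⁻¹ * (1 / 16 : ℝ) ^ n) atTop (𝓝 0) := by
      simpa using (tendsto_pow_atTop_nhds_zero_of_lt_one (r := (1 / 16 : ℝ)) (by norm_num)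
        (by norm_num)).const_mul a⁻¹
    rw [tendsto_iff_dist_tendsto_zero]
    refine squeeze_zero (fun _ => dist_nonneg) (fun n => ?_) hz
    have hM := two_mul_pow_le_padeRe ht0 n
    have hM' : (256 : ℝ) ^ n ≤ padeRe t n := hM.trans' (by gcongr; linarith)
    have hp : 0 < padeRe t n := hM'.trans_lt' (by positivity)
    have e : padeIm t n / padeRe t n - b / a = -(b * padeRe t n - a * padeIm t n) / (a * padeRe t n) := by
      field_simp
      ring
    rw [Real.dist_eq, e, abs_div, abs_neg, abs_of_pos (mul_pos ha hp),
      div_le_iff₀ (mul_pos ha hp)]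
    calc _ ≤ (16 : ℝ) ^ n := hbound n
      _ = (1 / 16 : ℝ) ^ n * 256 ^ n := by rw [← mul_pow]; norm_num
      _ ≤ (1 / 16 : ℝ) ^ n * padeRe t n := by gcongr
      _ = _ := by field_simp
  have hroot : b / a = -(eps t - rho t) := by
    have hge : g = a + b * Complex.I := (Complex.re_add_im g).symm
    have hre : a ^ 4 - 6 * a ^ 2 * b ^ 2 + b ^ 4 = t := by
      have h := congrArg Complex.re hg4
      simp [pow_succ] at h
      linear_combination h
    have him : 4 * a ^ 3 * b - 4 * a * b ^ 3 = 4 := by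
      have h := congrArg Complex.im hg4
      simp [pow_succ] at h
      linear_combination h
    set T := b / a with hT
    have hbT : b = T * a := by rw [hT]; field_simp
    have hT0 : 0 ≤ T := div_nonneg hb ha.le
    have hT1 : T ≤ 1 := (div_le_one ha).2 hab
    have hq := quartic_eq_prod t (-T)
    have hq0 : (-T) ^ 4 - t * (-T) ^ 3 - 6 * (-T) ^ 2 + t * (-T) + 1 = 0 := by
      have ha4 : a ^ 4 ≠ 0 := by positivity
      apply mul_left_cancel₀ ha4
      rw [hbT] at hre him
      linear_combination hre - (t : ℝ) / 4 * him
    rw [hq0] at hq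
    simp only [Fin.prod_univ_four, beta, Matrix.cons_val] at hq
    have he := eps_pos t
    have hr1 := one_lt_rho t
    have hr := rho_sq t
    have hlt := eps_lt_rho t
    have b1 : 0 < (rho t - 1) / eps t := div_pos (by linarith) he
    have b3 : 1 < (rho t + 1) / eps t := by rw [one_lt_div he]; linarith
    -- Among the four roots only `eps t - rho t` lies in [-1, 0].
    rcases mul_eq_zero.1 hq.symm with hq | hq
    · rcases mul_eq_zero.1 hq with hq | hq
      · rcases mul_eq_zero.1 hq with hq | hq
        · linarith
        · linarith
      · linarith
    · linarith
  rwa [← hroot]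

/-! ### From approximations to an irrationality measure -/

/-- An effective irrationality measure from a dense sequence of good rational approximations. -/
theorem lt_abs_sub_mul_of_approx {E x κ γ k β : ℝ} (hE : 1 < E) (hκ : E ^ κ = x) (hκ0 : 0 ≤ κ)
    (hk : 0 < k) {U V : ℕ → ℤ} (hV : ∀ n, |(V n : ℝ)| ≤ k * x ^ n)
    (herr : ∀ n, |(V n : ℝ) * β - U n| ≤ γ / (2 * E) * (1 / E) ^ n)
    (hdet : ∀ n, (U n : ℝ) * V (n + 1) - U (n + 1) * V n ≠ 0) {p q : ℤ}
    (hq : 1 ≤ γ * |(q : ℝ)|) :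
    1 / (2 * k * x * (γ * |(q : ℝ)|) ^ κ) < |(p : ℝ) - β * q| := by
  have hE0 : 0 < E := by linarith
  have hx : 0 < x := hκ ▸ Real.rpow_pos_of_pos hE0 _
  have hx1 : 1 ≤ x := hκ ▸ Real.one_le_rpow hE.le hκ0
  obtain ⟨r, hr1, hr2⟩ := exists_nat_pow_near hq hE
  -- If both consecutive forms vanished, p/q would equal two approximations that `hdet` separates.
  obtain ⟨n, hn1, hn2, hne⟩ : ∃ n, r ≤ n ∧ n ≤ r + 1 ∧ V n * p - U n * q ≠ 0 := by
    by_contra! h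
    have h1 := h r le_rfl (Nat.le_succ r)
    have h2 := h (r + 1) (Nat.le_succ r) le_rfl
    have h1' : (V r : ℝ) * p - U r * q = 0 := by exact_mod_cast h1
    have h2' : (V (r + 1) : ℝ) * p - U (r + 1) * q = 0 := by exact_mod_cast h2
    have hq0 : (q : ℝ) ≠ 0 := by
      rintro h0
      rw [h0, abs_zero, mul_zero] at hq
      linarith
    apply hdet r
    apply mul_right_cancel₀ hq0
    linear_combination V r * h2' - V (r + 1) * h1'
  have hone : (1 : ℝ) ≤ |(V n : ℝ) * p - U n * q| := by
    exact_mod_cast Int.one_le_abs hne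
  have hsplit : (V n : ℝ) * p - U n * q = V n * (p - β * q) + (V n * β - U n) * q := by ring
  have hsmall : |((V n : ℝ) * β - U n) * q| < 1 / 2 := by
    rw [abs_mul]
    calc |(V n : ℝ) * β - U n| * |(q : ℝ)| ≤ γ / (2 * E) * (1 / E) ^ n * |(q : ℝ)| := by
          gcongr
          exact herr n
      _ = (γ * |(q : ℝ)|) * (1 / (2 * E ^ (n + 1))) := by
          field_simp
          rw [div_pow, one_pow, pow_succ]
          field_simp
      _ < E ^ (n + 1) * (1 / (2 * E ^ (n + 1))) := by
          gcongr
          exact hr2.trans_le (pow_le_pow_right₀ hE.le (by omega))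
      _ = 1 / 2 := by field_simp
  have hbig : 1 / 2 < |(V n : ℝ)| * |(p : ℝ) - β * q| := by
    rw [← abs_mul]
    rw [hsplit] at hone
    linarith [abs_add_le ((V n : ℝ) * (p - β * q)) ((V n * β - U n) * q)]
  have hVn : |(V n : ℝ)| ≤ k * x * (γ * |(q : ℝ)|) ^ κ := by
    calc |(V n : ℝ)| ≤ k * x ^ n := hV n
      _ ≤ k * x ^ (r + 1) := by gcongr
      _ = k * x * (E ^ r) ^ κ := by
          rw [← hκ, ← Real.rpow_natCast E r, ← Real.rpow_mul hE0.le, mul_comm (r : ℝ) κ,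
            Real.rpow_mul hE0.le, Real.rpow_natCast, pow_succ]
          ring
      _ ≤ _ := by gcongr
  have hW : 0 < k * x * (γ * |(q : ℝ)|) ^ κ := by
    have : 0 < γ * |(q : ℝ)| := by linarith
    positivity
  rw [mul_assoc, mul_assoc, ← mul_assoc k, div_lt_iff₀ (by positivity)]
  have := mul_le_mul_of_nonneg_right hVn (abs_nonneg ((p : ℝ) - β * q))
  linarith

/-! ### Explicit bounds in terms of ε -/

theorem two_mul_eps_sq (t : ℤ) : 2 * eps t ^ 2 = t * eps t + 2 := by
  have hs : √((t : ℝ) ^ 2 + 16) ^ 2 = (t : ℝ) ^ 2 + 16 := Real.sq_sqrt (by positivity)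
  unfold eps
  linear_combination (1 / 8 : ℝ) * hs

theorem eps_bounds {t : ℤ} (ht : 128 ≤ t) : (t : ℝ) / 2 ≤ eps t ∧ eps t ≤ 0.5002 * t := by
  have htr : (128 : ℝ) ≤ t := by exact_mod_cast ht
  have he := eps_pos t
  have h := two_mul_eps_sq t
  have h1 : (t : ℝ) / 2 ≤ eps t := by nlinarith
  refine ⟨h1, ?_⟩
  nlinarith

theorem padeRe_pos {t : ℤ} (ht : 0 < t) (n : ℕ) : 0 < padeRe t n := by
  have htr : (0 : ℝ) < t := by exact_mod_cast ht
  exact (two_mul_pow_le_padeRe ht n).trans_lt' (by positivity)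

theorem padeIm_nonneg {t : ℤ} (ht : 0 < t) (n : ℕ) : 0 ≤ padeIm t n := by
  have htr : (0 : ℝ) < t := by exact_mod_cast ht
  exact (padeRec_re_im t).2.nonneg htr.le (by simp [padeIm_zero]) (by simp [padeIm_one]) n

theorem padeRe_le {t : ℤ} (ht : 128 ≤ t) (n : ℕ) : padeRe t n ≤ (8 * eps t) ^ n := by
  have htr : (128 : ℝ) ≤ t := by exact_mod_cast ht
  have h := (padeRec_re_im t).1.le_mul_pow (C := 1) (x := 8 * eps t) (by linarith)
    (padeRe_pos (by omega) 0).le (padeRe_pos (by omega) 1).le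
    (by linear_combination 32 * two_mul_eps_sq t) (by rw [padeRe_zero])
    (by rw [padeRe_one]; linarith [(eps_bounds ht).1]) n
  linarith

theorem padeIm_le {t : ℤ} (ht : 128 ≤ t) (n : ℕ) : padeIm t n ≤ 0.004 * (8 * eps t) ^ n := by
  have htr : (128 : ℝ) ≤ t := by exact_mod_cast ht
  exact (padeRec_re_im t).2.le_mul_pow (x := 8 * eps t) (by linarith)
    (padeIm_nonneg (by omega) 0) (padeIm_nonneg (by omega) 1)
    (by linear_combination 32 * two_mul_eps_sq t) (by rw [padeIm_zero]; norm_num)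
    (by rw [padeIm_one]; linarith [(eps_bounds ht).1]) n

/-- The case n = 0 fixes the constant: 2t / (8ε) is slightly below 1/2. -/
theorem pow_le_padeRe {t : ℤ} (ht : 128 ≤ t) (n : ℕ) :
    0.49 * (8 * eps t) ^ (n + 1) ≤ (n + 1) * padeRe t (n + 1) := by
  have htr : (128 : ℝ) ≤ t := by exact_mod_cast ht
  have h2 := (padeRec_re_im t).1 0
  rw [padeRe_zero, padeRe_one] at h2
  norm_num at h2
  have hb := (eps_bounds ht).2
  have he := two_mul_eps_sq t
  exact (padeRec_re_im t).1.pow_le_mul (by linarith) (padeRe_pos (by omega) 0).le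
    (padeRe_pos (by omega) 1).le (by linear_combination 32 * he)
    (by rw [padeRe_one]; linarith) (by nlinarith) n

theorem padeDet_ne_zero (t : ℤ) (n : ℕ) :
    padeIm t (n + 1) * padeRe t n - padeIm t n * padeRe t (n + 1) ≠ 0 :=
  (padeRec_re_im t).1.det_ne_zero (padeRec_re_im t).2
    (by simp [padeIm_zero, padeIm_one, padeRe_zero]) n

/-- The factors n + 1 in the Casoratian and growth bounds cancel, leaving 2 · 1.002 / 0.49 < 4.1. -/
theorem abs_padeRe_mul_sub_padeIm_le {t : ℤ} (ht : 128 ≤ t) (n : ℕ) :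
    |padeRe t n * (rho t - eps t) - padeIm t n| ≤ 4.1 / (8 * eps t) * (1 / (eps t / 8)) ^ n := by
  have htr : (128 : ℝ) ≤ t := by exact_mod_cast ht
  have he := eps_pos t
  obtain ⟨hre, him⟩ := padeRec_re_im t
  have hT := tendsto_padeIm_div_padeRe ht
  rw [neg_sub] at hT
  have h := hre.abs_sub_le him htr (by simp [padeRe_zero]) (by simp [padeRe_zero, padeRe_one]) hT n
  have hd := hre.abs_det_le him n
  rw [padeRe_zero, padeIm_zero, padeIm_one, zero_mul, sub_zero, mul_one, abs_two] at hd
  have hl := pow_le_padeRe ht n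
  have hp := padeRe_pos (t := t) (by omega) (n + 1)
  have hn : (0 : ℝ) < n + 1 := by positivity
  refine h.trans ?_
  have e : 4.1 / (8 * eps t) * (1 / (eps t / 8)) ^ n = 4.1 * 64 ^ n / (8 * eps t) ^ (n + 1) := by
    have : (1 / (eps t / 8)) = 64 / (8 * eps t) := by field_simp; norm_num
    rw [this, div_pow, pow_succ (8 * eps t)]
    field_simp
  rw [e, div_le_div_iff₀ hp (by positivity)]
  set D := |padeIm t (n + 1) * padeRe t n - padeIm t n * padeRe t (n + 1)|
  have hD : 0 ≤ D := abs_nonneg _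
  refine le_of_mul_le_mul_left ?_ hn
  calc (n + 1) * (1.002 * D * (8 * eps t) ^ (n + 1))
      = 1.002 * ((n + 1) * D) * (8 * eps t) ^ (n + 1) := by ring
    _ ≤ 1.002 * (2 * 64 ^ n) * (8 * eps t) ^ (n + 1) := by gcongr
    _ = (2.004 / 0.49) * 64 ^ n * (0.49 * (8 * eps t) ^ (n + 1)) := by ring
    _ ≤ (2.004 / 0.49) * 64 ^ n * ((n + 1) * padeRe t (n + 1)) := by gcongr
    _ ≤ 4.1 * 64 ^ n * ((n + 1) * padeRe t (n + 1)) := by gcongr; norm_num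
    _ = _ := by ring

theorem eps_div_eight_rpow_kappa {t : ℤ} (ht : 128 ≤ t) :
    1 < eps t / 8 ∧ (eps t / 8) ^ kappa t = 8 * eps t ∧ 0 ≤ kappa t := by
  have htr : (128 : ℝ) ≤ t := by exact_mod_cast ht
  have hb := (eps_bounds ht).1
  have h1 : 1 < eps t / 8 := by linarith
  have hl := Real.log_pos h1
  refine ⟨h1, ?_, ?_⟩
  · rw [Real.rpow_def_of_pos (by linarith), kappa, mul_div_cancel₀ _ hl.ne',
      Real.exp_log (by linarith)]
  · exact div_nonneg (Real.log_nonneg (by linarith)) hl.le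

/-! ### The four roots -/

/-- The irrationality measure obtained from approximations `U n / V n` whose error terms are
controlled by the Padé remainders. -/
theorem lt_abs_sub_mul_of_pade {t : ℤ} (ht : 128 ≤ t) {β γ k L C : ℝ} (hk : 0 < k)
    {U V : ℕ → ℤ} (hV : ∀ n, |(V n : ℝ)| ≤ k * (8 * eps t) ^ n)
    (herr : ∀ n, |(V n : ℝ) * β - U n| ≤ L * |padeRe t n * (rho t - eps t) - padeIm t n|)
    (hL0 : 0 ≤ L) (hL : 4.1 * L ≤ 32 * γ)
    (hdet : ∀ n, (U n : ℝ) * V (n + 1) - U (n + 1) * V n ≠ 0) {p q : ℤ}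
    (hγ : 0 ≤ γ) (hq : 1 ≤ γ * |(q : ℝ)|) (hC : 2 * k * (8 * eps t) ≤ C) :
    1 / (C * γ ^ kappa t * |(q : ℝ)| ^ kappa t) < |(p : ℝ) - β * q| := by
  obtain ⟨hE, hκ, hκ0⟩ := eps_div_eight_rpow_kappa ht
  have he := eps_pos t
  have h := lt_abs_sub_mul_of_approx hE hκ hκ0 hk hV (γ := γ) (β := β) (fun n => ?_) hdet
    (p := p) hq
  · refine h.trans_le' ?_
    have hpos : 0 < (γ * |(q : ℝ)|) ^ kappa t := Real.rpow_pos_of_pos (by linarith) _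
    rw [mul_assoc, ← Real.mul_rpow hγ (abs_nonneg _)]
    gcongr
  · refine (herr n).trans ?_
    calc _ ≤ L * (4.1 / (8 * eps t) * (1 / (eps t / 8)) ^ n) := by
          gcongr
          exact abs_padeRe_mul_sub_padeIm_le ht n
      _ = (4.1 * L) / (8 * eps t) * (1 / (eps t / 8)) ^ n := by ring
      _ ≤ (32 * γ) / (8 * eps t) * (1 / (eps t / 8)) ^ n := by gcongr
      _ = _ := by
          congr 1
          field_simp
          ring

theorem one_div_lt_abs_sub_beta_mul (t : ℤ) (ht : 128 ≤ t) (j : Fin 4) (p q : ℤ)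
    (hq : 0.16 * (t : ℝ) < |(q : ℝ)|) :
    1 / (c t j * |(q : ℝ)| ^ kappa t) <
      |(p : ℝ) - beta t j * (q : ℝ)| := by
  have htr : (128 : ℝ) ≤ t := by exact_mod_cast ht
  obtain ⟨hb1, hb2⟩ := eps_bounds ht
  have he := eps_pos t
  have hρ := rho_sq t
  have hρ1 := one_lt_rho t
  have hT0 := eps_lt_rho t
  have hTr : (rho t - eps t) * (rho t + eps t) = 1 := by linear_combination hρ
  have hT1 : rho t - eps t ≤ 1 / 128 := by nlinarith
  have hM := fun n => padeRe_le ht n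
  have hM0 := fun n => (padeRe_pos (t := t) (by omega) n).le
  have hN := fun n => padeIm_le ht n
  have hN0 := fun n => padeIm_nonneg (t := t) (by omega) n
  have hD := padeDet_ne_zero t
  have hq1 : 1 ≤ 0.4 * |(q : ℝ)| := by linarith
  have hX : ∀ n, 0 ≤ (8 * eps t) ^ n := fun n => by positivity
  fin_cases j <;> simp only [beta, c, Fin.zero_eta, Fin.mk_one, Fin.reduceFinMk, Matrix.cons_val]
  -- Here β = -T. The value k = 1.4 gives 2k · 8ε ≤ 11.33 t, and γ = 0.4 allows every L ≤ 3.
  · refine lt_abs_sub_mul_of_pade ht (k := 1.4) (L := 1) (by norm_num)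
      (U := fun n => -(padeGauss t n).im) (V := fun n => (padeGauss t n).re) (fun n => ?_)
      (fun n => ?_) (by norm_num) (by norm_num) (fun n => ?_) (by norm_num) hq1 (by linarith)
    · show |padeRe t n| ≤ _
      rw [abs_of_nonneg (hM0 n)]
      linarith [hM n, hX n]
    · push_cast
      show |padeRe t n * _ - -padeIm t n| ≤ _
      rw [one_mul, ← abs_neg]
      exact le_of_eq (congrArg abs (by ring))
    · push_cast
      show -padeIm t n * padeRe t (n + 1) - -padeIm t (n + 1) * padeRe t n ≠ 0
      intro h
      exact hD n (by linear_combination h)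
  -- β = (1 - T)/(1 + T); the Möbius map scales the error by 2/(1 + T) ≤ 2.
  · refine lt_abs_sub_mul_of_pade ht (k := 1.4) (L := 2) (by norm_num)
      (U := fun n => (padeGauss t n).re - (padeGauss t n).im)
      (V := fun n => (padeGauss t n).re + (padeGauss t n).im) (fun n => ?_)
      (fun n => ?_) (by norm_num) (by norm_num) (fun n => ?_) (by norm_num) hq1 (by linarith)
    · push_cast
      show |padeRe t n + padeIm t n| ≤ _
      rw [abs_of_nonneg (add_nonneg (hM0 n) (hN0 n))]
      linarith [hM n, hN n, hX n]
    · push_cast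
      show |(padeRe t n + padeIm t n) * _ - (padeRe t n - padeIm t n)| ≤ _
      have hβ : (rho t - 1) / eps t = (1 - (rho t - eps t)) / (1 + (rho t - eps t)) := by
        rw [div_eq_div_iff he.ne' (by linarith)]
        linear_combination hρ
      have e : (padeRe t n + padeIm t n) * ((rho t - 1) / eps t) - (padeRe t n - padeIm t n) =
          -(2 / (1 + (rho t - eps t))) * (padeRe t n * (rho t - eps t) - padeIm t n) := by
        have : 1 + (rho t - eps t) ≠ 0 := by linarith
        rw [hβ]
        field_simp
        ring
      rw [e, abs_mul, abs_neg]
      gcongr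
      rw [abs_of_pos (div_pos two_pos (by linarith)), div_le_iff₀ (by linarith)]
      linarith
    · push_cast
      show (padeRe t n - padeIm t n) * (padeRe t (n + 1) + padeIm t (n + 1)) -
        (padeRe t (n + 1) - padeIm t (n + 1)) * (padeRe t n + padeIm t n) ≠ 0
      intro h
      exact hD n (by linear_combination h / 2)
  -- β = 1/T; the error is scaled by 1/T, of size about t, which forces γ = 0.4 t.
  · refine lt_abs_sub_mul_of_pade ht (k := 1) (L := rho t + eps t) (by norm_num)
      (U := fun n => (padeGauss t n).re) (V := fun n => (padeGauss t n).im) (fun n => ?_)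
      (fun n => ?_) (by linarith) (by linarith) (fun n => ?_) (by linarith) (by nlinarith)
      (by linarith)
    · show |padeIm t n| ≤ _
      rw [abs_of_nonneg (hN0 n)]
      linarith [hN n, hX n]
    · show |padeIm t n * _ - padeRe t n| ≤ _
      have e : padeIm t n * (rho t + eps t) - padeRe t n =
          -(rho t + eps t) * (padeRe t n * (rho t - eps t) - padeIm t n) := by
        linear_combination padeRe t n * hTr
      rw [e, abs_mul, abs_neg, abs_of_pos (by linarith : 0 < rho t + eps t)]
    · show padeRe t n * padeIm t (n + 1) - padeRe t (n + 1) * padeIm t n ≠ 0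
      intro h
      exact hD n (by linear_combination h)
  -- β = -(1 + T)/(1 - T); the error is scaled by 2/(1 - T) ≤ 3, since T ≤ 1/128.
  · refine lt_abs_sub_mul_of_pade ht (k := 1.4) (L := 3) (by norm_num)
      (U := fun n => -((padeGauss t n).re + (padeGauss t n).im))
      (V := fun n => (padeGauss t n).re - (padeGauss t n).im) (fun n => ?_)
      (fun n => ?_) (by norm_num) (by norm_num) (fun n => ?_) (by norm_num) hq1 (by linarith)
    · push_cast
      show |padeRe t n - padeIm t n| ≤ _
      rw [abs_le]
      constructor <;> linarith [hM n, hN n, hX n, hM0 n, hN0 n]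
    · push_cast
      show |(padeRe t n - padeIm t n) * _ - -(padeRe t n + padeIm t n)| ≤ _
      have hβ : (rho t + 1) / eps t = (1 + (rho t - eps t)) / (1 - (rho t - eps t)) := by
        rw [div_eq_div_iff he.ne' (by linarith)]
        linear_combination -hρ
      have e : (padeRe t n - padeIm t n) * -((rho t + 1) / eps t) - -(padeRe t n + padeIm t n) =
          -(2 / (1 - (rho t - eps t))) * (padeRe t n * (rho t - eps t) - padeIm t n) := by
        have : 1 - (rho t - eps t) ≠ 0 := by linarith
        rw [hβ]
        field_simp
        ring
      rw [e, abs_mul, abs_neg]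
      gcongr
      rw [abs_of_pos (div_pos two_pos (by linarith)), div_le_iff₀ (by linarith)]
      linarith
    · push_cast
      show -(padeRe t n + padeIm t n) * (padeRe t (n + 1) - padeIm t (n + 1)) -
        -(padeRe t (n + 1) + padeIm t (n + 1)) * (padeRe t n - padeIm t n) ≠ 0
      intro h
      exact hD n (by linear_combination h / 2)

end SimplestQuartic

theorem theorem4 (t : ℤ) (ht : 128 ≤ t) (j : Fin 4) (p q : ℤ)
    (hq : 0.16 * (t : ℝ) < |(q : ℝ)|) :
    1 / (SimplestQuartic.c t j * |(q : ℝ)| ^ SimplestQuartic.kappa t) <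
      |(p : ℝ) - SimplestQuartic.beta t j * (q : ℝ)| :=
  SimplestQuartic.one_div_lt_abs_sub_beta_mul t ht j p q hq
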